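/- Let $k$ be a field, let $n\ge 0$, and let $S=k[x_1,\dots,x_n]$. Let $\Delta$ be a simplicial complex on $[n]=\{1,\dots,n\}$, that is, a collection of subsets of $[n]$ (its faces) closed under taking subsets, and let $I=I_\Delta=\bigl(\prod_{i\in F}x_i : F\subseteq[n],\ F\notin\Delta\bigr)\subseteq S$ be its Stanley–Reisner ideal. For $m\in\mathbb N$ let $$I^{(m)}=\bigcap_{\mathfrak p\in\operatorname{Min}(I)}\bigl(I^mS_{\mathfrak p}\cap S\bigr)$$ be the $m$-th symbolic power of $I$, where $\operatorname{Min}(I)$ is the set of minimal primes of $I$; equivalently, $I^{(m)}=\bigcap_{F}(x_i : i\in [n]\setminus F)^m$, where $F$ runs over the facets (maximal faces) of $\Delta$. For a monomial ideal $J\subseteq S$, the quotient $S/J$ is called clean if there are a chain of monomial ideals $J=J_0\subsetneq J_1\subsetneq\cdots\subsetneq J_r=S$ and monomial prime ideals $\mathfrak p_1,\dots,\mathfrak p_r$ of $S$ such that $J_i/J_{i-1}\cong S/\mathfrak p_i$ as $S$-modules for $i=1,\dots,r$ and $\{\mathfrak p_1,\dots,\mathfrak p_r\}=\operatorname{Min}(J)$.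 **Theorem.** If $\Delta$ is a matroid, that is, if for all faces $F,G\in\Delta$ with $|F|<|G|$ there exists $i\in G\setminus F$ with $F\cup\{i\}\in\Delta$, then $S/I^{(m)}$ is clean for every $m\in\mathbb N$. -/

import Mathlib

open MvPolynomial

/-- A simplicial complex on the vertex set `Fin n`: a collection of subsets closed under passing
to subsets. Not every vertex has to be a face, and the complexes `∅` and `{∅}` are different. -/
abbrev SimplicialComplexOn (n : ℕ) : Type := LowerSet (Finset (Fin n))

/-- A simplicial complex is a matroid if for all faces `F`, `G` with `|F| < |G|` there is
`i ∈ G \ F` such that `F ∪ {i}` is a face. -/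
def SimplicialComplexOn.IsMatroid {n : ℕ} (Δ : SimplicialComplexOn n) : Prop :=
  ∀ F ∈ Δ, ∀ G ∈ Δ, F.card < G.card → ∃ i ∈ G \ F, insert i F ∈ Δ

/-- The Stanley-Reisner ideal `I_Δ = (∏_{i ∈ F} x_i : F ∉ Δ)`. -/
noncomputable def stanleyReisnerIdeal (k : Type*) [Field k] {n : ℕ} (Δ : SimplicialComplexOn n) :
    Ideal (MvPolynomial (Fin n) k) :=
  Ideal.span {f | ∃ F : Finset (Fin n), F ∉ Δ ∧ f = ∏ i ∈ F, X i}

/-- The `m`-th symbolic power of an ideal `I` without embedded primes (such as a radical ideal):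
the intersection, over the minimal primes `p` of `I`, of the contractions `I ^ m R_p ∩ R`. -/
noncomputable def symbolicPower {R : Type*} [CommRing R] (I : Ideal R) (m : ℕ) : Ideal R :=
  ⨅ p : I.minimalPrimes,
    haveI : p.1.IsPrime := p.2.1.1
    ((I ^ m).map (algebraMap R (Localization.AtPrime p.1))).comap
      (algebraMap R (Localization.AtPrime p.1))

/-- A monomial ideal: an ideal generated by a set of monomials. -/
def IsMonomialIdeal {σ k : Type*} [Field k] (I : Ideal (MvPolynomial σ k)) : Prop :=
  ∃ A : Set (σ →₀ ℕ), I = Ideal.span ((fun a => monomial a (1 : k)) '' A)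

/-- A prime filtration of `S/I`: a strictly increasing chain of monomial ideals
`I = I_0 ⊂ I_1 ⊂ ⋯ ⊂ I_r = S` together with monomial prime ideals `p_1, …, p_r` such that
`I_i / I_{i-1} ≅ S / p_i` as `S`-modules. (`r = 0` occurs exactly for `I = S`.) -/
structure PrimeFiltration {σ k : Type*} [Field k] (I : Ideal (MvPolynomial σ k)) where
  length : ℕ
  ideal : Fin (length + 1) → Ideal (MvPolynomial σ k)
  prime : Fin length → Ideal (MvPolynomial σ k)
  ideal_zero : ideal 0 = I
  ideal_last : ideal (Fin.last length) = ⊤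
  ideal_lt : ∀ i : Fin length, ideal i.castSucc < ideal i.succ
  isMonomialIdeal_ideal : ∀ i, IsMonomialIdeal (ideal i)
  isPrime_prime : ∀ i, (prime i).IsPrime
  isMonomialIdeal_prime : ∀ i, IsMonomialIdeal (prime i)
  quotient_equiv : ∀ i : Fin length, Nonempty
    ((ideal i.succ ⧸ (ideal i.castSucc).submoduleOf (ideal i.succ))
      ≃ₗ[MvPolynomial σ k] (MvPolynomial σ k ⧸ prime i))

/-- The set of prime ideals `{p_1, …, p_r}` of a prime filtration. -/
def PrimeFiltration.support {σ k : Type*} [Field k] {I : Ideal (MvPolynomial σ k)}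
    (𝓕 : PrimeFiltration I) : Set (Ideal (MvPolynomial σ k)) :=
  Set.range 𝓕.prime

/-- `S/I` is clean: it has a prime filtration whose set of primes is the set of minimal primes
of `S/I`. -/
def IsCleanQuotient {σ k : Type*} [Field k] (I : Ideal (MvPolynomial σ k)) : Prop :=
  ∃ 𝓕 : PrimeFiltration I, 𝓕.support = I.minimalPrimes

/-! The complements of the facets, a family `𝓓`, are the bases of the dual matroid, and `I^(m)` is
spanned by the `x^a` with `∑_{i ∈ D} a_i ≥ m` for all `D ∈ 𝓓`. For the induction this is enlarged to
the ideals `weightExponents 𝓓 m K c`, where the variables in `K` have been added and `c` records the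
variables divided out. Choose `e ∉ K` with `c e` minimal among the elements of members of `𝓓`
containing `K`. The colon by `x_e` raises `c e` by one; by basis exchange and minimality, adding
`x_e` just puts `e` into `K` (`weightExponents_union_Ici_single`). Both ideals stay in the family,
and filtrations of their quotients splice (`HasExponentFiltration.of_colon`). The induction ends at
the unit ideal or at a prime `(x_i : i ∈ K)` with `K ∈ 𝓓`. So every prime of the filtration comes
from the antichain `𝓓`, which forces these primes to be exactly the minimal ones
(`HasExponentFiltration.isCleanQuotient`). -/

/-- Combinatorial prime filtrations of a set `U` of exponents of monomials: one adds successively to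
`U` the multiples of monomials `u` such that `(U : u)` is the set of exponents of the monomial prime
`(x_i : i ∈ D)` for some `D ∈ 𝓓`, until all exponents are reached. -/
inductive HasExponentFiltration {σ : Type*} (𝓓 : Set (Finset σ)) : Set (σ →₀ ℕ) → Prop
  | univ : HasExponentFiltration 𝓓 Set.univ
  | cons (U : Set (σ →₀ ℕ)) (u : σ →₀ ℕ) (D : Finset σ) (hD : D ∈ 𝓓)
      (hu : ∀ a, a + u ∈ U ↔ ∃ i ∈ D, a i ≠ 0)
      (h : HasExponentFiltration 𝓓 (U ∪ Set.Ici u)) : HasExponentFiltration 𝓓 U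

/-! ### Splicing exponent filtrations -/

namespace HasExponentFiltration

variable {σ : Type*} {𝓓 : Set (Finset σ)}

/-- Multiplication by `x^v` carries a filtration of `S/(U : x^v)` to one from `U` up to `U + (x^v)`,
where the given filtration takes over. -/
theorem of_colon {V : Set (σ →₀ ℕ)} (hV : HasExponentFiltration 𝓓 V) :
    ∀ {U : Set (σ →₀ ℕ)} {v : σ →₀ ℕ}, IsUpperSet U → V = {a | a + v ∈ U} →
      HasExponentFiltration 𝓓 (U ∪ Set.Ici v) → HasExponentFiltration 𝓓 U := by
  induction hV with
  | univ =>
    intro U v hU hUV h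
    have hv : v ∈ U := by
      have : (0 : σ →₀ ℕ) ∈ {a | a + v ∈ U} := hUV ▸ Set.mem_univ _
      simpa using this
    have hle : Set.Ici v ⊆ U := fun a ha => hU ha hv
    rwa [Set.union_eq_self_of_subset_right hle] at h
  | cons V u D hD hu _ ih =>
    intro U v hU hUV h
    refine cons U (u + v) D hD (fun a => ?_) (ih (v := v) (hU.union (isUpperSet_Ici _)) ?_ ?_)
    · rw [← hu, hUV, Set.mem_ofPred_eq, add_assoc]
    · ext a
      simp [hUV]
    · rwa [Set.union_assoc, Set.union_eq_self_of_subset_left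
        (Set.Ici_subset_Ici.2 (le_add_of_nonneg_left bot_le))]

end HasExponentFiltration

/-- The exponents of the monomials lying in the ideal generated by the variables in `K` and by the
monomials `x ^ a` such that `∑ i ∈ D, (a i + c i) ≥ m` for all `D ∈ 𝓓` containing `K`. -/
def weightExponents {σ : Type*} (𝓓 : Set (Finset σ)) (m : ℕ) (K : Finset σ) (c : σ →₀ ℕ) :
    Set (σ →₀ ℕ) :=
  {a | (∃ i ∈ K, a i ≠ 0) ∨ ∀ D ∈ 𝓓, K ⊆ D → m ≤ ∑ i ∈ D, (a i + c i)}

theorem isUpperSet_weightExponents {σ : Type*} (𝓓 : Set (Finset σ)) (m : ℕ) (K : Finset σ)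
    (c : σ →₀ ℕ) : IsUpperSet (weightExponents 𝓓 m K c) := by
  rintro a b hab (⟨i, hi, hai⟩ | h)
  · exact Or.inl ⟨i, hi, fun h0 => hai (Nat.le_zero.1 (h0 ▸ hab i))⟩
  · exact Or.inr fun D hD hK => (h D hD hK).trans
      (Finset.sum_le_sum fun i _ => Nat.add_le_add_right (hab i) _)

theorem weightExponents_eq_univ {σ : Type*} {𝓓 : Set (Finset σ)} {m : ℕ} {K : Finset σ}
    {c : σ →₀ ℕ} (h : ∀ D ∈ 𝓓, K ⊆ D → ∃ f ∈ D, m ≤ c f) : weightExponents 𝓓 m K c = Set.univ := by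
  refine Set.eq_univ_of_forall fun a => Or.inr fun D hD hK => ?_
  obtain ⟨f, hf, hm⟩ := h D hD hK
  exact (hm.trans (Nat.le_add_left _ _)).trans
    (Finset.single_le_sum (f := fun i => a i + c i) (fun _ _ => Nat.zero_le _) hf)

theorem weightExponents_colon_single {σ : Type*} {𝓓 : Set (Finset σ)} {m : ℕ}
    {K : Finset σ} {c : σ →₀ ℕ} {e : σ} (he : e ∉ K) :
    weightExponents 𝓓 m K (c + .single e 1) =
      {a | a + .single e 1 ∈ weightExponents 𝓓 m K c} := by
  ext a
  simp only [weightExponents, Set.mem_ofPred_eq, Finsupp.add_apply]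
  refine or_congr (exists_congr fun i => and_congr_right fun hi => ?_) ?_
  · rw [Finsupp.single_eq_of_ne (ne_of_mem_of_not_mem hi he), add_zero]
  · simp only [add_comm, add_left_comm]

/-! ### Basis exchange and the main induction -/

section Exchange

variable {σ : Type*} [DecidableEq σ] {𝓓 : Set (Finset σ)}

/-- The dual basis exchange property: an element of `D₀` can be added to `D`, in exchange for some
element of `D` outside of `D₀`. -/
def HasExchange (𝓓 : Set (Finset σ)) : Prop :=
  ∀ D ∈ 𝓓, ∀ D₀ ∈ 𝓓, ∀ e ∈ D₀ \ D, ∃ f ∈ D \ D₀, insert e (D.erase f) ∈ 𝓓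

theorem weightExponents_union_Ici_single (h𝓓 : HasExchange 𝓓) {m : ℕ} {K D₀ : Finset σ}
    {c : σ →₀ ℕ} {e : σ} (hD₀ : D₀ ∈ 𝓓) (hK : K ⊆ D₀) (he : e ∈ D₀)
    (hmin : ∀ D ∈ 𝓓, K ⊆ D → ∀ f ∈ D \ K, c e ≤ c f) :
    weightExponents 𝓓 m K c ∪ Set.Ici (.single e 1) = weightExponents 𝓓 m (insert e K) c := by
  ext a
  simp only [weightExponents, Set.mem_ofPred_eq, Set.mem_union, Set.mem_Ici, Finsupp.single_le_iff,
    Finset.exists_mem_insert, Nat.one_le_iff_ne_zero]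
  by_cases hae : a e = 0
  swap
  · simp [hae]
  by_cases haK : ∃ i ∈ K, a i ≠ 0
  · simp [haK]
  simp only [hae, haK, ne_eq, not_true, false_or, or_false]
  refine ⟨fun h D hD hKD => h D hD ((Finset.subset_insert _ _).trans hKD), fun h D hD hKD => ?_⟩
  by_cases heD : e ∈ D
  · exact h D hD (Finset.insert_subset heD hKD)
  -- As `a e = 0`, trading `f` for `e` replaces `a f + c f` by `c e ≤ c f`, so the sum over `D` is
  -- at least the sum over `D - f + e`, a member containing `e` and `K`.
  obtain ⟨f, hf, hD'⟩ := h𝓓 D hD D₀ hD₀ e (Finset.mem_sdiff.2 ⟨he, heD⟩)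
  rw [Finset.mem_sdiff] at hf
  have hfK : f ∉ K := fun h => hf.2 (hK h)
  refine (h _ hD' (Finset.insert_subset_insert _ (Finset.subset_erase.2 ⟨hKD, hfK⟩))).trans ?_
  rw [Finset.sum_insert (fun h => heD (Finset.mem_of_mem_erase h)),
    ← Finset.add_sum_erase D _ hf.1, hae]
  have := hmin D hD hKD f (Finset.mem_sdiff.2 ⟨hf.1, hfK⟩)
  omega

theorem hasExponentFiltration_weightExponents [Fintype σ] (h𝓓 : HasExchange 𝓓)
    (hanti : IsAntichain (· ⊆ ·) 𝓓) (m : ℕ) (K : Finset σ) (c : σ →₀ ℕ) :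
    HasExponentFiltration 𝓓 (weightExponents 𝓓 m K c) := by
  -- The subtraction is truncated; the measure drops in both branches only because `c e < m` there,
  -- so `m ≤ c e` is treated separately.
  induction hN : ∑ i ∈ Kᶜ, (m - c i) using Nat.strong_induction_on generalizing K c with
  | _ N ih =>
  replace ih (K' : Finset σ) (c' : σ →₀ ℕ) (h : ∑ i ∈ K'ᶜ, (m - c' i) < N) :
      HasExponentFiltration 𝓓 (weightExponents 𝓓 m K' c') := ih _ h K' c' rfl
  by_cases hloop : ∀ D ∈ 𝓓, K ⊆ D → D = K
  · by_cases hK : K ∈ 𝓓 ∧ ∑ i ∈ K, c i < m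
    · refine .cons _ 0 K hK.1 (fun a => ?_) ?_
      · rw [add_zero]
        refine or_iff_left_of_imp fun h => ?_
        by_contra! ha
        refine hK.2.not_ge ((h K hK.1 subset_rfl).trans_eq (Finset.sum_congr rfl fun i hi => ?_))
        rw [ha i hi, zero_add]
      · rw [← bot_eq_zero, Set.Ici_bot, Set.union_univ]
        exact .univ
    · have : weightExponents 𝓓 m K c = Set.univ := by
        refine Set.eq_univ_of_forall fun a => Or.inr fun D hD hKD => ?_
        obtain rfl := hloop D hD hKD
        exact (not_lt.1 (not_and.1 hK hD)).trans
          (Finset.sum_le_sum fun i _ => Nat.le_add_left _ _)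
      exact this ▸ .univ
  push Not at hloop
  obtain ⟨D₁, hD₁, hKD₁, hne⟩ := hloop
  obtain ⟨e₁, he₁⟩ : (D₁ \ K).Nonempty :=
    Finset.sdiff_nonempty.2 fun h => hne (h.antisymm hKD₁)
  obtain ⟨e, ⟨D₀, hD₀, hKD₀, he⟩, hmin⟩ := exists_minimalFor_of_wellFoundedLT
    (fun e => ∃ D ∈ 𝓓, K ⊆ D ∧ e ∈ D \ K) (fun e => c e) ⟨e₁, D₁, hD₁, hKD₁, he₁⟩
  replace hmin : ∀ D ∈ 𝓓, K ⊆ D → ∀ f ∈ D \ K, c e ≤ c f := fun D hD hK f hf =>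
    (le_total (c e) (c f)).elim id fun h => hmin ⟨D, hD, hK, hf⟩ h
  rw [Finset.mem_sdiff] at he
  by_cases hm : m ≤ c e
  · rw [weightExponents_eq_univ]
    · exact .univ
    intro D hD hKD
    -- Otherwise `D = K` would lie properly inside `D₀`.
    obtain ⟨f, hf⟩ : (D \ K).Nonempty := by
      refine Finset.sdiff_nonempty.2 fun h => ?_
      obtain rfl := h.antisymm hKD
      exact he.2 (hanti.eq hD hD₀ hKD₀ ▸ he.1)
    exact ⟨f, (Finset.mem_sdiff.1 hf).1, hm.trans (hmin D hD hKD f hf)⟩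
  have heK : e ∈ Kᶜ := Finset.mem_compl.2 he.2
  have hcolon : HasExponentFiltration 𝓓 (weightExponents 𝓓 m K (c + .single e 1)) := by
    refine ih _ _ (hN ▸ Finset.sum_lt_sum (fun i _ => ?_) ⟨e, heK, ?_⟩)
    · rw [Finsupp.add_apply]; omega
    · rw [Finsupp.add_apply, Finsupp.single_eq_same]; omega
  refine hcolon.of_colon (isUpperSet_weightExponents _ _ _ _)
    (weightExponents_colon_single he.2) ?_
  rw [weightExponents_union_Ici_single h𝓓 hD₀ hKD₀ he.1 hmin]
  refine ih _ _ ?_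
  rw [← hN, Finset.compl_insert, ← Finset.add_sum_erase _ _ heK]
  omega

end Exchange

/-! ### Monomial ideals and powers of monomial primes -/

section MonomialIdeals

variable {σ : Type*} (k : Type*) [Field k]

/-- The ideal generated by the monomials with exponents in `U`. -/
noncomputable def exponentIdeal (U : Set (σ →₀ ℕ)) : Ideal (MvPolynomial σ k) :=
  Ideal.span ((fun a => monomial a (1 : k)) '' U)

/-- The monomial prime ideal `(x_i : i ∈ D)`. -/
noncomputable def variableIdeal (D : Finset σ) : Ideal (MvPolynomial σ k) :=
  Ideal.span (X '' (D : Set σ))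

variable {k}

theorem mem_exponentIdeal_iff {U : Set (σ →₀ ℕ)} (hU : IsUpperSet U) {f : MvPolynomial σ k} :
    f ∈ exponentIdeal k U ↔ ∀ a ∈ f.support, a ∈ U := by
  rw [exponentIdeal, mem_ideal_span_monomial_image]
  exact forall₂_congr fun a _ => ⟨fun ⟨b, hb, hba⟩ => hU hba hb, fun h => ⟨a, h, le_rfl⟩⟩

theorem monomial_mem_exponentIdeal {U : Set (σ →₀ ℕ)} {a : σ →₀ ℕ} (ha : a ∈ U) :
    monomial a (1 : k) ∈ exponentIdeal k U :=
  Ideal.subset_span ⟨a, ha, rfl⟩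

theorem exponentIdeal_union_Ici (U : Set (σ →₀ ℕ)) (u : σ →₀ ℕ) :
    exponentIdeal k (U ∪ Set.Ici u) = exponentIdeal k U ⊔ Ideal.span {monomial u 1} := by
  rw [exponentIdeal, Set.image_union, Ideal.span_union]
  refine congrArg _ (le_antisymm (Ideal.span_le.2 ?_) (Ideal.span_mono ?_))
  · rintro _ ⟨a, ha, rfl⟩
    obtain ⟨b, rfl⟩ := exists_add_of_le (Set.mem_Ici.1 ha)
    exact Ideal.mem_span_singleton.2 ⟨monomial b 1, by simp [monomial_mul]⟩
  · rw [Set.singleton_subset_iff]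
    exact ⟨u, Set.self_mem_Ici, rfl⟩

theorem exponentIdeal_univ : exponentIdeal k (Set.univ : Set (σ →₀ ℕ)) = ⊤ :=
  (Ideal.eq_top_iff_one _).2 (monomial_mem_exponentIdeal (Set.mem_univ 0))

theorem isMonomialIdeal_exponentIdeal (U : Set (σ →₀ ℕ)) : IsMonomialIdeal (exponentIdeal k U) :=
  ⟨U, rfl⟩

theorem mem_variableIdeal_iff {D : Finset σ} {f : MvPolynomial σ k} :
    f ∈ variableIdeal k D ↔ ∀ a ∈ f.support, ∃ i ∈ D, a i ≠ 0 :=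
  mem_ideal_span_X_image

theorem isMonomialIdeal_variableIdeal (D : Finset σ) : IsMonomialIdeal (variableIdeal k D) :=
  ⟨(fun i => Finsupp.single i 1) '' D, by rw [Set.image_image]; rfl⟩

theorem X_mem_variableIdeal_iff {D : Finset σ} {i : σ} :
    X i ∈ variableIdeal k D ↔ i ∈ D := by
  classical
  simp [mem_variableIdeal_iff, support_X, Finsupp.single_apply]

theorem variableIdeal_le_iff {D : Finset σ} {I : Ideal (MvPolynomial σ k)} :
    variableIdeal k D ≤ I ↔ ∀ i ∈ D, X i ∈ I := by
  simp [variableIdeal, Ideal.span_le, Set.subset_def]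

theorem variableIdeal_le_variableIdeal_iff {D E : Finset σ} :
    variableIdeal k D ≤ variableIdeal k E ↔ D ⊆ E := by
  simp [variableIdeal_le_iff, X_mem_variableIdeal_iff, Finset.subset_iff]

theorem weight_indicator_eq_sum [DecidableEq σ] (D : Finset σ) (a : σ →₀ ℕ) :
    Finsupp.weight (fun i => if i ∈ D then 1 else 0) a = ∑ i ∈ D, a i := by
  rw [Finsupp.weight_apply, Finsupp.sum]
  simp only [smul_eq_mul, mul_ite, mul_one, mul_zero]
  rw [← Finset.sum_filter, Finset.filter_mem_eq_inter]
  refine Finset.sum_subset Finset.inter_subset_right fun i hi h => ?_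
  simpa [hi] using h

theorem monomial_mem_variableIdeal_pow (D : Finset σ) (a : σ →₀ ℕ) :
    monomial a (1 : k) ∈ variableIdeal k D ^ ∑ i ∈ D, a i := by
  classical
  rw [monomial_eq, Finsupp.prod, map_one, one_mul]
  have h : ∏ i ∈ D, (X i : MvPolynomial σ k) ^ a i ∣ ∏ i ∈ a.support, X i ^ a i := by
    rw [← Finset.prod_subset (Finset.inter_subset_left (s₁ := D) (s₂ := a.support))]
    · exact Finset.prod_dvd_prod_of_subset _ _ _ Finset.inter_subset_right
    · intro i hi h
      have : a i = 0 := by simpa [hi] using h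
      rw [this, pow_zero]
  refine Ideal.mem_of_dvd _ h ?_
  rw [← Finset.prod_pow_eq_pow_sum]
  exact Ideal.prod_mem_prod fun i hi => Ideal.pow_mem_pow (X_mem_variableIdeal_iff.2 hi) _

theorem mem_variableIdeal_pow_iff {D : Finset σ} {m : ℕ} {f : MvPolynomial σ k} :
    f ∈ variableIdeal k D ^ m ↔ ∀ a ∈ f.support, m ≤ ∑ i ∈ D, a i := by
  classical
  have hU (m : ℕ) : IsUpperSet {a : σ →₀ ℕ | m ≤ ∑ i ∈ D, a i} := fun a b hab ha =>
    le_trans (Set.mem_ofPred.1 ha) (Finset.sum_le_sum fun i _ => hab i)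
  suffices variableIdeal k D ^ m = exponentIdeal k {a | m ≤ ∑ i ∈ D, a i} by
    rw [this, mem_exponentIdeal_iff (hU m)]; rfl
  refine le_antisymm ?_ (Ideal.span_le.2 ?_)
  · induction m with
    | zero => simp [exponentIdeal_univ]
    | succ m ih =>
      rw [pow_succ]
      refine Ideal.mul_le.2 fun f hf g hg => (mem_exponentIdeal_iff (hU _)).2 fun a ha => ?_
      obtain ⟨b, hb, c, hc, rfl⟩ := Finset.mem_add.1 (support_mul f g ha)
      obtain ⟨i, hi, hci⟩ := mem_variableIdeal_iff.1 hg c hc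
      have hbm : m ≤ ∑ i ∈ D, b i := (mem_exponentIdeal_iff (hU _)).1 (ih hf) b hb
      have hcm : c i ≤ ∑ i ∈ D, c i := Finset.single_le_sum (fun _ _ => Nat.zero_le _) hi
      simp only [Set.mem_ofPred_eq, Finsupp.add_apply, Finset.sum_add_distrib]
      omega
  · rintro _ ⟨a, ha, rfl⟩
    exact Ideal.pow_le_pow_right ha (monomial_mem_variableIdeal_pow D a)

theorem le_weightedOrder_iff_mem_variableIdeal_pow [DecidableEq σ] {D : Finset σ} {m : ℕ}
    {f : MvPolynomial σ k} :
    (m : ℕ∞) ≤ (f : MvPowerSeries σ k).weightedOrder (fun i => if i ∈ D then 1 else 0) ↔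
      f ∈ variableIdeal k D ^ m := by
  rw [mem_variableIdeal_pow_iff]
  refine ⟨fun h a ha => ?_, fun h => MvPowerSeries.nat_le_weightedOrder _ fun a ha => ?_⟩
  · rw [← weight_indicator_eq_sum, ← Nat.cast_le (α := ℕ∞)]
    exact h.trans (MvPowerSeries.weightedOrder_le _ (by rwa [coeff_coe, ← mem_support_iff]))
  · rw [weight_indicator_eq_sum] at ha
    by_contra h0
    rw [coeff_coe, ← ne_eq, ← mem_support_iff] at h0
    exact ha.not_ge (h a h0)

/-- The powers of a monomial prime ideal are primary. -/
theorem mem_variableIdeal_pow_of_mul_mem {D : Finset σ} {m : ℕ} {s f : MvPolynomial σ k}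
    (hs : s ∉ variableIdeal k D) (h : s * f ∈ variableIdeal k D ^ m) :
    f ∈ variableIdeal k D ^ m := by
  classical
  set w : σ → ℕ := fun i => if i ∈ D then 1 else 0
  by_contra hf
  have hs0 : ((0 : ℕ) : ℕ∞) = (s : MvPowerSeries σ k).weightedOrder w := by
    by_contra hne
    refine hs ?_
    rw [← pow_one (variableIdeal k D), ← le_weightedOrder_iff_mem_variableIdeal_pow]
    exact Order.one_le_iff_pos.2 (pos_iff_ne_zero.2 (Ne.symm hne))
  rw [← le_weightedOrder_iff_mem_variableIdeal_pow, not_le] at hf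
  obtain ⟨q, hq⟩ := ENat.ne_top_iff_exists.1 hf.ne_top
  -- Weighting by the indicator of `D`, the lowest components of `s` (weight 0) and `f` (weight `q <
  -- m`) are nonzero, but their product is the weight-`q` component of `s * f`, which vanishes.
  have hmul := MvPowerSeries.weightedHomogeneousComponent_mul_of_le_weightedOrder hs0.le hq.le
  rw [← le_weightedOrder_iff_mem_variableIdeal_pow, coe_mul] at h
  rw [MvPowerSeries.weightedHomogeneousComponent_of_lt_weightedOrder_eq_zero
    (by rw [zero_add, hq]; exact hf.trans_le h)] at hmul
  exact mul_ne_zero (MvPowerSeries.weightedHomogeneousComponent_of_weightedOrder hs0)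
    (MvPowerSeries.weightedHomogeneousComponent_of_weightedOrder hq) hmul.symm

theorem isPrime_variableIdeal (D : Finset σ) : (variableIdeal k D).IsPrime := by
  refine ⟨(Ideal.ne_top_iff_one _).2 fun h => ?_, fun {s f} h => or_iff_not_imp_left.2 fun hs => ?_⟩
  · simpa using mem_variableIdeal_iff.1 h 0
  · rw [← pow_one (variableIdeal k D)] at h ⊢
    exact mem_variableIdeal_pow_of_mul_mem hs h

end MonomialIdeals

/-! ### From exponent filtrations to cleanness -/

section Filtration

variable {σ k : Type*} [Field k]

/-- If `J = I + (x)`, then `J / I` is isomorphic to `S / (I : x)`. -/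
theorem nonempty_quotient_equiv_of_colon {R : Type*} [CommRing R] {I J P : Ideal R} {x : R}
    (hJ : J = I ⊔ Ideal.span {x}) (hP : ∀ f, f * x ∈ I ↔ f ∈ P) :
    Nonempty ((J ⧸ I.submoduleOf J) ≃ₗ[R] (R ⧸ P)) := by
  have hx : x ∈ J := hJ ▸ Ideal.mem_sup_right (Ideal.mem_span_singleton_self x)
  let φ : R →ₗ[R] J ⧸ I.submoduleOf J :=
    (I.submoduleOf J).mkQ ∘ₗ LinearMap.toSpanSingleton R J ⟨x, hx⟩
  have hker : LinearMap.ker φ = P := by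
    ext f
    rw [LinearMap.mem_ker, ← hP]
    exact Submodule.Quotient.mk_eq_zero _
  have hsurj : Function.Surjective φ := by
    intro y
    obtain ⟨⟨y, hy⟩, rfl⟩ := Submodule.Quotient.mk_surjective _ y
    have hy' := hy
    rw [hJ] at hy'
    obtain ⟨g, hg, z, hz, rfl⟩ := Submodule.mem_sup.1 hy'
    obtain ⟨f, rfl⟩ := Ideal.mem_span_singleton'.1 hz
    refine ⟨f, (Submodule.Quotient.eq _).2 ?_⟩
    change f * x - (g + f * x) ∈ I
    rw [show f * x - (g + f * x) = -g by ring]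
    exact I.neg_mem hg
  exact ⟨((Submodule.quotEquivOfEq _ _ hker.symm).trans
    (φ.quotKerEquivOfSurjective hsurj)).symm⟩

/-- The prime filtration of length `0` of the zero module. -/
noncomputable def PrimeFiltration.top (h : IsMonomialIdeal (⊤ : Ideal (MvPolynomial σ k))) :
    PrimeFiltration (⊤ : Ideal (MvPolynomial σ k)) where
  length := 0
  ideal _ := ⊤
  prime := Fin.elim0
  ideal_zero := rfl
  ideal_last := rfl
  ideal_lt i := i.elim0
  isMonomialIdeal_ideal _ := h
  isPrime_prime i := i.elim0
  isMonomialIdeal_prime i := i.elim0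
  quotient_equiv i := i.elim0

/-- Prolongs a prime filtration of `S / J` by one step `I ⊂ J`. -/
noncomputable def PrimeFiltration.cons {I J P : Ideal (MvPolynomial σ k)}
    (𝓕 : PrimeFiltration J) (hIJ : I < J) (hI : IsMonomialIdeal I)
    (hP : P.IsPrime) (hPm : IsMonomialIdeal P)
    (e : Nonempty ((J ⧸ I.submoduleOf J) ≃ₗ[MvPolynomial σ k] (MvPolynomial σ k ⧸ P))) :
    PrimeFiltration I where
  length := 𝓕.length + 1
  ideal := Fin.cons I 𝓕.ideal
  prime := Fin.cons P 𝓕.prime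
  ideal_zero := rfl
  ideal_last := by
    rw [← Fin.succ_last, Fin.cons_succ, 𝓕.ideal_last]
  ideal_lt := by
    refine Fin.cases ?_ fun i => ?_
    · rw [Fin.castSucc_zero, Fin.cons_zero, Fin.cons_succ, 𝓕.ideal_zero]
      exact hIJ
    · rw [Fin.castSucc_succ, Fin.cons_succ, Fin.cons_succ]
      exact 𝓕.ideal_lt i
  isMonomialIdeal_ideal := Fin.cases hI 𝓕.isMonomialIdeal_ideal
  isPrime_prime := Fin.cases hP 𝓕.isPrime_prime
  isMonomialIdeal_prime := Fin.cases hPm 𝓕.isMonomialIdeal_prime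
  quotient_equiv := by
    refine Fin.cases ?_ fun i => ?_
    · rw [Fin.castSucc_zero, Fin.cons_zero, Fin.cons_succ, Fin.cons_zero, 𝓕.ideal_zero]
      exact e
    · rw [Fin.castSucc_succ, Fin.cons_succ, Fin.cons_succ, Fin.cons_succ]
      exact 𝓕.quotient_equiv i

theorem PrimeFiltration.support_cons {I J P : Ideal (MvPolynomial σ k)} (𝓕 : PrimeFiltration J)
    (hIJ : I < J) (hI : IsMonomialIdeal I)
    (hP : P.IsPrime) (hPm : IsMonomialIdeal P)
    (e : Nonempty ((J ⧸ I.submoduleOf J) ≃ₗ[MvPolynomial σ k] (MvPolynomial σ k ⧸ P))) :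
    (𝓕.cons hIJ hI hP hPm e).support = insert P 𝓕.support :=
  Fin.range_cons P 𝓕.prime

/-- For the last clause: a prime over the ideal either contains `x^u`, hence the next ideal of the
chain, or contains the colon by `x^u`, which is the prime of that step. -/
theorem HasExponentFiltration.exists_primeFiltration {𝓓 : Set (Finset σ)} {U : Set (σ →₀ ℕ)}
    (h : HasExponentFiltration 𝓓 U) (hU : IsUpperSet U) :
    ∃ 𝓕 : PrimeFiltration (exponentIdeal k U), 𝓕.support ⊆ variableIdeal k '' 𝓓 ∧
      (∀ P ∈ 𝓕.support, exponentIdeal k U ≤ P) ∧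
      ∀ Q : Ideal (MvPolynomial σ k), Q.IsPrime → exponentIdeal k U ≤ Q →
        ∃ P ∈ 𝓕.support, P ≤ Q := by
  classical
  induction h with
  | univ =>
    rw [exponentIdeal_univ]
    refine ⟨.top ⟨Set.univ, exponentIdeal_univ.symm⟩, ?_, ?_, fun Q hQ h =>
      (hQ.ne_top (top_le_iff.1 h)).elim⟩
    · rintro _ ⟨i, -⟩
      exact i.elim0
    · rintro _ ⟨i, -⟩
      exact i.elim0
  | cons U u D hD hu _ ih =>
    obtain ⟨𝓕, hsupp, hle, hex⟩ := ih (hU.union (isUpperSet_Ici u))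
    have hcolon (f : MvPolynomial σ k) :
        f * monomial u 1 ∈ exponentIdeal k U ↔ f ∈ variableIdeal k D := by
      rw [mem_exponentIdeal_iff hU, mem_variableIdeal_iff]
      simp only [← hu]
      refine ⟨fun h a ha => h _ ?_, fun h a ha => ?_⟩
      · rw [mem_support_iff] at ha ⊢
        rwa [coeff_mul_monomial, mul_one]
      · obtain ⟨b, hb, c, hc, rfl⟩ := Finset.mem_add.1 (support_mul _ _ ha)
        rw [Finset.mem_singleton.1 (support_monomial_subset hc)]
        exact h b hb
    have hIJ := exponentIdeal_union_Ici (k := k) U u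
    have hle' : exponentIdeal k U ≤ exponentIdeal k (U ∪ Set.Ici u) := hIJ ▸ le_sup_left
    have hlt : exponentIdeal k U < exponentIdeal k (U ∪ Set.Ici u) := by
      refine lt_of_le_not_ge hle' fun hge => (isPrime_variableIdeal (k := k) D).one_notMem ?_
      rw [← hcolon, one_mul]
      exact hge (monomial_mem_exponentIdeal (Or.inr Set.self_mem_Ici))
    refine ⟨𝓕.cons hlt (isMonomialIdeal_exponentIdeal U) (isPrime_variableIdeal D)
      (isMonomialIdeal_variableIdeal D) (nonempty_quotient_equiv_of_colon hIJ hcolon), ?_⟩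
    rw [PrimeFiltration.support_cons]
    refine ⟨Set.insert_subset ⟨D, hD, rfl⟩ hsupp, ?_, fun Q hQ hUQ => ?_⟩
    · rintro P (rfl | hP)
      · exact fun f hf => (hcolon f).1 (Ideal.mul_mem_right _ _ hf)
      · exact hle'.trans (hle P hP)
    · by_cases hmon : monomial u 1 ∈ Q
      · obtain ⟨P, hP, hPQ⟩ := hex Q hQ
          (hIJ ▸ sup_le hUQ ((Ideal.span_singleton_le_iff_mem _).2 hmon))
        exact ⟨P, Or.inr hP, hPQ⟩
      · exact ⟨_, Or.inl rfl, fun f hf =>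
          (hQ.mem_or_mem (hUQ ((hcolon f).2 hf))).resolve_right hmon⟩

theorem HasExponentFiltration.isCleanQuotient {𝓓 : Set (Finset σ)} {U : Set (σ →₀ ℕ)}
    (h : HasExponentFiltration 𝓓 U) (hU : IsUpperSet U) (h𝓓 : IsAntichain (· ⊆ ·) 𝓓) :
    IsCleanQuotient (exponentIdeal k U) := by
  obtain ⟨𝓕, hsupp, hle, hex⟩ := h.exists_primeFiltration (k := k) hU
  have hanti : ∀ P ∈ 𝓕.support, ∀ Q ∈ 𝓕.support, P ≤ Q → P = Q := by
    intro P hP Q hQ hPQ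
    obtain ⟨D, hD, rfl⟩ := hsupp hP
    obtain ⟨E, hE, rfl⟩ := hsupp hQ
    rw [h𝓓.eq hD hE (variableIdeal_le_variableIdeal_iff.1 hPQ)]
  refine ⟨𝓕, Set.Subset.antisymm (fun P hP => ?_) fun P hP => ?_⟩
  · refine ⟨⟨?_, hle P hP⟩, fun Q hQ hQP => ?_⟩
    · obtain ⟨i, rfl⟩ := hP
      exact 𝓕.isPrime_prime i
    · obtain ⟨P', hP', hP'Q⟩ := hex Q hQ.1 hQ.2
      exact hanti P' hP' P hP (hP'Q.trans hQP) ▸ hP'Q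
  · obtain ⟨Q, hQ, hQP⟩ := hex P hP.1.1 hP.1.2
    have hQprime : Q.IsPrime := by
      obtain ⟨i, rfl⟩ := hQ
      exact 𝓕.isPrime_prime i
    exact (hQP.antisymm (hP.2 ⟨hQprime, hle Q hQ⟩ hQP)) ▸ hQ

end Filtration

/-! ### Cofacets and symbolic powers of Stanley–Reisner ideals -/

section StanleyReisner

variable {k : Type*} [Field k] {n : ℕ} {Δ : SimplicialComplexOn n}

/-- The complements of the facets of a simplicial complex. -/
def SimplicialComplexOn.cofacets (Δ : SimplicialComplexOn n) : Set (Finset (Fin n)) :=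
  {D | Maximal (· ∈ Δ) Dᶜ}

theorem SimplicialComplexOn.isAntichain_cofacets : IsAntichain (· ⊆ ·) Δ.cofacets :=
  fun _ hD E (hE : Maximal (· ∈ Δ) Eᶜ) hne hDE => hne (compl_injective
    (hE.eq_of_le (Maximal.prop (P := (· ∈ Δ)) hD) (Finset.compl_subset_compl.2 hDE)).symm)

theorem SimplicialComplexOn.IsMatroid.hasExchange_cofacets (hΔ : Δ.IsMatroid) :
    HasExchange Δ.cofacets := by
  intro D hD D₀ hD₀ e he
  rw [Finset.mem_sdiff] at he
  -- Facets have maximal cardinality, so after removing `e` a facet can be augmented from `D₀ᶜ`, and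
  -- the result is a facet by its size.
  have hcard {B C : Finset (Fin n)} (hB : Maximal (· ∈ Δ) B) (hC : C ∈ Δ) : C.card ≤ B.card := by
    by_contra! hlt
    obtain ⟨i, hi, hiB⟩ := hΔ B hB.prop C hC hlt
    exact (Finset.mem_sdiff.1 hi).2 (hB.le_of_ge hiB (Finset.subset_insert i B)
      (Finset.mem_insert_self i B))
  have heB : e ∈ Dᶜ := Finset.mem_compl.2 he.2
  have hpos := Finset.card_erase_add_one heB
  obtain ⟨f, hf, hfΔ⟩ := hΔ (Dᶜ.erase e) (Δ.lower (Finset.erase_subset e Dᶜ) hD.prop) D₀ᶜ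
    hD₀.prop (by have := hcard hD₀ hD.prop; omega)
  simp only [Finset.mem_sdiff, Finset.mem_compl, Finset.mem_erase, not_and, not_not] at hf
  have hfe : f ≠ e := fun h => hf.1 (h ▸ he.1)
  have hfD : f ∈ D := hf.2 hfe
  refine ⟨f, Finset.mem_sdiff.2 ⟨hfD, hf.1⟩, ?_⟩
  have hcompl : (insert e (D.erase f))ᶜ = insert f (Dᶜ.erase e) := by
    rw [Finset.compl_insert, Finset.compl_erase, Finset.erase_insert_of_ne hfe]
  change Maximal (· ∈ Δ) _
  rw [hcompl]
  refine ⟨hfΔ, fun C hC hle => (Finset.eq_of_subset_of_card_le hle ?_).ge⟩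
  rw [Finset.card_insert_of_notMem (by simp [hfD]), hpos]
  exact hcard hD hC

theorem stanleyReisnerIdeal_le_iff {Q : Ideal (MvPolynomial (Fin n) k)} (hQ : Q.IsPrime) :
    stanleyReisnerIdeal k Δ ≤ Q ↔ ∃ D ∈ Δ.cofacets, variableIdeal k D ≤ Q := by
  classical
  constructor
  · intro h
    -- The variables outside `Q` form a face: a nonface would put their product into `Q`.
    have hF : Finset.univ.filter (fun i => (X i : MvPolynomial (Fin n) k) ∉ Q) ∈ Δ := by
      by_contra hF
      obtain ⟨i, hi, hiQ⟩ := hQ.prod_mem_iff.1 (h (Ideal.subset_span ⟨_, hF, rfl⟩))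
      exact (Finset.mem_filter.1 hi).2 hiQ
    obtain ⟨B, hFB, hB⟩ := Finite.exists_le_maximal (p := (· ∈ Δ)) hF
    refine ⟨Bᶜ, by simpa [SimplicialComplexOn.cofacets] using hB, variableIdeal_le_iff.2 ?_⟩
    intro i hi
    by_contra hiQ
    exact Finset.mem_compl.1 hi (hFB (by simpa using hiQ))
  · rintro ⟨D, hD, hDQ⟩
    refine Ideal.span_le.2 ?_
    rintro _ ⟨F, hF, rfl⟩
    obtain ⟨i, hiF, hiD⟩ : ∃ i ∈ F, i ∈ D := by
      by_contra! h
      exact hF (Δ.lower (fun i hi => Finset.mem_compl.2 (h i hi)) hD.prop)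
    exact hQ.prod_mem_iff.2 ⟨i, hiF, variableIdeal_le_iff.1 hDQ i hiD⟩

theorem minimalPrimes_stanleyReisnerIdeal :
    (stanleyReisnerIdeal k Δ).minimalPrimes = variableIdeal k '' Δ.cofacets := by
  ext P
  constructor
  · rintro ⟨⟨hP, hle⟩, hmin⟩
    obtain ⟨D, hD, hDP⟩ := (stanleyReisnerIdeal_le_iff hP).1 hle
    have hDp := isPrime_variableIdeal (k := k) D
    exact ⟨D, hD, hDP.antisymm
      (hmin ⟨hDp, (stanleyReisnerIdeal_le_iff hDp).2 ⟨D, hD, le_rfl⟩⟩ hDP)⟩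
  · rintro ⟨D, hD, rfl⟩
    have hDp := isPrime_variableIdeal (k := k) D
    refine ⟨⟨hDp, (stanleyReisnerIdeal_le_iff hDp).2 ⟨D, hD, le_rfl⟩⟩, fun Q hQ hQD => ?_⟩
    obtain ⟨E, hE, hEQ⟩ := (stanleyReisnerIdeal_le_iff hQ.1).1 hQ.2
    rw [← SimplicialComplexOn.isAntichain_cofacets.eq hE hD
      (variableIdeal_le_variableIdeal_iff.1 (hEQ.trans hQD))]
    exact hEQ

/-- A facet enlarged by a vertex is a nonface. The facet monomial is invertible at the prime of `D`,
so the two ideals agree after localization there. -/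
theorem prod_compl_mul_mem_stanleyReisnerIdeal {D : Finset (Fin n)} (hD : D ∈ Δ.cofacets)
    {f : MvPolynomial (Fin n) k} (hf : f ∈ variableIdeal k D) :
    (∏ i ∈ Dᶜ, X i) * f ∈ stanleyReisnerIdeal k Δ := by
  have : variableIdeal k D ≤ (stanleyReisnerIdeal k Δ).colon {∏ i ∈ Dᶜ, X i} := by
    refine variableIdeal_le_iff.2 fun i hi => Submodule.mem_colon_singleton.2 ?_
    have hi' : i ∉ Dᶜ := by simpa using hi
    rw [smul_eq_mul, ← Finset.prod_insert hi']
    refine Ideal.subset_span ⟨_, fun h => hi' ?_, rfl⟩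
    exact hD.le_of_ge h (Finset.subset_insert i _) (Finset.mem_insert_self i _)
  rw [mul_comm]
  exact Submodule.mem_colon_singleton.1 (this hf)

theorem comap_map_stanleyReisnerIdeal_pow {D : Finset (Fin n)} (hD : D ∈ Δ.cofacets) (m : ℕ)
    [(variableIdeal k D).IsPrime] :
    ((stanleyReisnerIdeal k Δ ^ m).map
      (algebraMap _ (Localization.AtPrime (variableIdeal k D)))).comap (algebraMap _ _) =
      variableIdeal k D ^ m := by
  have hle : stanleyReisnerIdeal k Δ ≤ variableIdeal k D :=
    (stanleyReisnerIdeal_le_iff inferInstance).2 ⟨D, hD, le_rfl⟩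
  ext f
  rw [Ideal.mem_comap, IsLocalization.algebraMap_mem_map_algebraMap_iff
    (variableIdeal k D).primeCompl]
  constructor
  · rintro ⟨s, hs, h⟩
    exact mem_variableIdeal_pow_of_mul_mem hs (Ideal.pow_right_mono hle m h)
  · intro hf
    refine ⟨(∏ i ∈ Dᶜ, X i) ^ m, Submonoid.pow_mem _ (fun h => ?_) m, ?_⟩
    · obtain ⟨i, hi, hiD⟩ := Ideal.IsPrime.prod_mem_iff.1 h
      exact Finset.mem_compl.1 hi ((X_mem_variableIdeal_iff (k := k)).1 hiD)
    · have h := Ideal.mul_mem_mul (Ideal.mem_span_singleton_self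
        ((∏ i ∈ Dᶜ, X i : MvPolynomial (Fin n) k) ^ m)) hf
      rw [← Ideal.span_singleton_pow, ← mul_pow] at h
      refine Ideal.pow_right_mono (Ideal.span_singleton_mul_le_iff.2 fun g hg => ?_) m h
      exact prod_compl_mul_mem_stanleyReisnerIdeal hD hg

theorem symbolicPower_stanleyReisnerIdeal (m : ℕ) :
    symbolicPower (stanleyReisnerIdeal k Δ) m =
      exponentIdeal k (weightExponents Δ.cofacets m ∅ 0) := by
  have h : symbolicPower (stanleyReisnerIdeal k Δ) m =
      ⨅ D ∈ Δ.cofacets, variableIdeal k D ^ m := by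
    refine le_antisymm (le_iInf₂ fun D hD => ?_) (le_iInf ?_)
    · have hDp := isPrime_variableIdeal (k := k) D
      rw [← comap_map_stanleyReisnerIdeal_pow hD m]
      have hmin : variableIdeal k D ∈ (stanleyReisnerIdeal k Δ).minimalPrimes := by
        rw [minimalPrimes_stanleyReisnerIdeal]
        exact ⟨D, hD, rfl⟩
      exact iInf_le_of_le ⟨variableIdeal k D, hmin⟩ le_rfl
    · rintro ⟨P, hP⟩
      have hP' := hP
      rw [minimalPrimes_stanleyReisnerIdeal] at hP'
      obtain ⟨D, hD, rfl⟩ := hP'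
      have hDp := isPrime_variableIdeal (k := k) D
      exact (iInf₂_le D hD).trans (comap_map_stanleyReisnerIdeal_pow hD m).ge
  ext f
  rw [h, mem_exponentIdeal_iff (isUpperSet_weightExponents _ _ _ _)]
  simp only [Submodule.mem_iInf, mem_variableIdeal_pow_iff, weightExponents, Set.mem_ofPred_eq,
    Finset.notMem_empty, false_and, exists_false, false_or, Finset.empty_subset, true_imp_iff,
    Finsupp.coe_zero, Pi.zero_apply, add_zero]
  exact ⟨fun h a ha D hD => h D hD a ha, fun h D hD a ha => h a ha D hD⟩

end StanleyReisner

theorem theorem2p1 (k : Type*) [Field k] (n : ℕ) (Δ : SimplicialComplexOn n) (hΔ : Δ.IsMatroid)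
    (m : ℕ) : IsCleanQuotient (symbolicPower (stanleyReisnerIdeal k Δ) m) := by
  rw [symbolicPower_stanleyReisnerIdeal]
  exact (hasExponentFiltration_weightExponents hΔ.hasExchange_cofacets
    SimplicialComplexOn.isAntichain_cofacets m ∅ 0).isCleanQuotient
      (isUpperSet_weightExponents _ _ _ _) SimplicialComplexOn.isAntichain_cofacets
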